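/- **Setting.** SIMPLE is the language with programs $\mathtt{main}(x_1:\tau_1,\dots,x_k:\tau_k):\tau\,\{s\}$, statements $s ::= s_1;s_2 \mid x:=e \mid \mathtt{if}\,(e)\,\{s_1\}\,\mathtt{else}\,\{s_2\} \mid \mathtt{while}\,(e)\,\{s\}$ and expressions $e ::= x \mid op(e_1,\dots,e_n)$, over an arbitrary set of types that contains $\mathtt{bool}$ and an arbitrary set of typed, possibly partial, primitive operations. An evaluation context $\Sigma$ is a partial map from variables to values; $[\![s]\!]$ is the partial function on evaluation contexts given by the standard operational semantics (undefined on non-termination), and $[\![\mathtt{main}]\!](\Sigma)=[\![s]\!](\Sigma)(\mathtt{retvar})$. Typing judgments are $\Gamma\vdash e:\tau$ and $\Gamma\vdash s:\Gamma'$ for finite type contexts $\Gamma$ (with $\Gamma\vdash s_1;s_2:\Gamma''$ if $\Gamma\vdash s_1:\Gamma'$ and $\Gamma'\vdash s_2:\Gamma''$; $\Gamma\vdash x:=e:(\Gamma,x:\tau)$ if $\Gamma\vdash e:\tau$; a Boolean guard and equal resulting contexts $\Gamma'$ of both branches for a conditional; a Boolean guard and $\Gamma\vdash s:\Gamma$ for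 a loop, whose resulting context is $\Gamma$; and $\Gamma\vdash s:\Gamma''$ if $\Gamma\vdash s:\Gamma'$ and $\Gamma''\subseteq\Gamma'$). A program is well-typed if $x_1:\tau_1,\dots,x_k:\tau_k\vdash s:\Gamma$ with $\Gamma(\mathtt{retvar})=\tau$. A PEG is a graph whose nodes $n$ carry a label $L(n)$ and an ordered list $C(n)$ of children. Labels are $param(x)$ (no children) or semantic functions on loop-lifted values, i.e. on functions from $\mathbb I=\mathbb N\to\mathbb N$ (iteration vectors, indexed by loop depth) to values or $\bot$. Domain operations, constants and negation are lifted pointwise and strictly in $\bot$. With $\mathit{mon}_\ell(v)(\mathbf i)=\bot$ if $v(\mathbf i[\ell\mapsto j])=\bot$ for some $j<\mathbf i(\ell)$, and $\mathit{mon}_\ell(v)(\mathbf i)=v(\mathbf i)$ otherwise, the primitive functions are: - $\phi(c,t,f)(\mathbf i)$ is $t(\mathbf i)$, $f(\mathbf i)$ or $\bot$ as $c(\mathbf i)$ is true, false or $\bot$; - $\theta_\ell(b,r)(\mathbf i)$ is $b(\mathbf i)$ if $\mathbf i(\ell)=0$ and $r(\mathbf i[\ell\mapsto\mathbf i(\ell)-1])$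 otherwise; - $\mathit{pass}_\ell(c)(\mathbf i)$ is the least $j$ with $\mathit{mon}_\ell(c)(\mathbf i[\ell\mapsto j])$ true, and $\bot$ if there is none; - $\mathit{eval}_\ell(r,p)(\mathbf i)$ is $\mathit{mon}_\ell(r)(\mathbf i[\ell\mapsto p(\mathbf i)])$, and $\bot$ if $p(\mathbf i)=\bot$. For a PEG without parameter nodes, the semantic values $[\![n]\!]$ are the unique solution of the equations $[\![n]\!]=L(n)([\![C(n)]\!])$. The type-directed translation is defined by recursion on typing derivations. It sends a node context $\Psi$ (mapping each variable of $\Gamma$ to a node) and a derivation of $\Gamma\vdash e:\tau$ to a node, and, at loop depth $\ell$, sends $\Psi$ and a derivation of $\Gamma\vdash s:\Gamma'$ to a node context $\Psi'$ on the variables of $\Gamma'$: - a variable $x$ gives $\Psi(x)$, and $op(e_1,\dots,e_n)$ gives a node labeled $op$ whose children are the translations of the $e_i$; - a sequence composes the translations, an assignment $x:=e$ rebinds $x$ to the translation of $e$, and forgetting variables restricts $\Psi'$; - a conditional gives $x\mapsto\phi(n,n_{x,1},n_{x,2})$, where $n$ is the translation of the guard and the $n_{x,j}$ come from the two branches, all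 translated from $\Psi$; - a loop with guard $e$ and body $s$ is translated by taking a fresh node $v_x$ for each $x\in\Gamma$, translating $e$ to $n$ and $s$ (at depth $\ell+1$) to $(n'_x)_x$ in the node context $(v_x)_x$, unifying $v_x$ with $\theta_{\ell+1}(\Psi(x),n'_x)$, and returning $x\mapsto\mathit{eval}_{\ell+1}(v_x,\mathit{pass}_{\ell+1}(\neg n))$. Finally, $\vdash\mathtt{main}(x_1:\tau_1,\dots,x_k:\tau_k):\tau\,\{s\}\rhd n$ means that translating $s$ at depth $0$, starting from $x_i\mapsto param(x_i)$, gives a node context whose value at $\mathtt{retvar}$ is $n$. **Theorem.** If (1) $\vdash\mathtt{main}(x_1:\tau_1,\dots,x_k:\tau_k):\tau\,\{s\}\rhd n$, (2) $\Sigma$ is an evaluation context mapping each $x_i$ to a value $\nu_i$ of type $\tau_i$, and (3) $\hat n=n[x_1\mapsto\nu_1,\dots,x_k\mapsto\nu_k]$ is obtained by replacing each parameter node $param(x_i)$ of the PEG by a constant node $\nu_i$, then for every value $\nu$ $$[\![\mathtt{main}]\!](\Sigma)=\nu\implies[\![\hat n]\!](\lambda\ell.\,0)=\nu ,$$ where the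 right-hand side includes that the semantic values of the substituted PEG are well defined (the recursive equations have a unique solution). -/

import Mathlib

universe u

noncomputable section

namespace Simple

/-- The parameters of the language SIMPLE: variables with the special variable `retvar`, an
arbitrary set of types containing a Boolean type, the set of values of each type, and an arbitrary
set of typed primitive operations, each interpreted by a (possibly partial) function. -/
structure Signature where
  Var : Type u
  decVar : DecidableEq Var
  retvar : Var
  Ty : Type u
  boolTy : Ty
  Val : Ty → Type u
  boolEquiv : Val boolTy ≃ Bool
  Op : Type u
  arity : Op → ℕ
  argTy : (o : Op) → Fin (arity o) → Ty
  resTy : Op → Ty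
  opSem : (o : Op) → ((i : Fin (arity o)) → Val (argTy o i)) → Option (Val (resTy o))

attribute [instance] Signature.decVar

variable (S : Signature.{u})

/-- A value, tagged with its type. -/
abbrev Value : Type u := Σ τ : S.Ty, S.Val τ

variable {S} in
/-- The Boolean values `true` and `false`. -/
def ofBool (b : Bool) : Value S := ⟨S.boolTy, S.boolEquiv.symm b⟩

open Classical in
variable {S} in
/-- The `⊥`-lifted operation (`none` is `⊥`): undefined as soon as some argument is undefined.
(It is also undefined on ill-typed arguments, which are outside the domain of the operation.) -/
def liftOp (o : S.Op) (vs : Fin (S.arity o) → Option (Value S)) : Option (Value S) :=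
  if h : ∀ i, ∃ v : S.Val (S.argTy o i), vs i = some ⟨S.argTy o i, v⟩ then
    (S.opSem o fun i => (h i).choose).map fun r => ⟨S.resTy o, r⟩
  else none

/-! ### SIMPLE programs -/

/-- Expressions `e ::= x | op(e₁, …, eₖ)`. -/
inductive Expr : Type u
  | var (x : S.Var) : Expr
  | op (o : S.Op) (args : Fin (S.arity o) → Expr) : Expr

/-- Statements `s ::= s₁; s₂ | x := e | if (e) {s₁} else {s₂} | while (e) {s}`. -/
inductive Stmt : Type u
  | seq (s₁ s₂ : Stmt) : Stmt
  | asgn (x : S.Var) (e : Expr S) : Stmt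
  | ite (e : Expr S) (s₁ s₂ : Stmt) : Stmt
  | while (e : Expr S) (s : Stmt) : Stmt

/-- A program `main(x₁ : τ₁, …, xₖ : τₖ) : τ {s}`. -/
structure Program : Type u where
  params : List (S.Var × S.Ty)
  retTy : S.Ty
  body : Stmt S

/-- Type contexts `Γ`. -/
abbrev Ctx : Type u := S.Var → Option S.Ty

variable {S}

/-- The variables on which a type context is defined. -/
abbrev Ctx.Dom (Γ : Ctx S) : Type u := {x : S.Var // Γ x ≠ none}

/-- The context `(Γ, x : τ)`. -/
def Ctx.extend (Γ : Ctx S) (x : S.Var) (τ : S.Ty) : Ctx S := Function.update Γ x (some τ)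

/-- The context `{x₁ : τ₁, …, xₖ : τₖ}`. -/
def Ctx.ofParams (ps : List (S.Var × S.Ty)) : Ctx S :=
  ps.foldl (fun Γ b => Γ.extend b.1 b.2) fun _ => none

/-- `Γ'' ⊆ Γ'`. -/
def Ctx.Sub (Γ'' Γ' : Ctx S) : Prop := ∀ x τ, Γ'' x = some τ → Γ' x = some τ

/-- Derivations of `Γ ⊢ e : τ`. -/
inductive ExprTyping (Γ : Ctx S) : Expr S → S.Ty → Type u
  | var (x : S.Var) (τ : S.Ty) (h : Γ x = some τ) : ExprTyping Γ (.var x) τ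
  | op (o : S.Op) (args : Fin (S.arity o) → Expr S)
      (h : (i : Fin (S.arity o)) → ExprTyping Γ (args i) (S.argTy o i)) :
      ExprTyping Γ (.op o args) (S.resTy o)

/-- Derivations of `Γ ⊢ s : Γ'`. -/
inductive StmtTyping : Ctx S → Stmt S → Ctx S → Type u
  | seq {Γ Γ' Γ'' : Ctx S} {s₁ s₂ : Stmt S} (h₁ : StmtTyping Γ s₁ Γ')
      (h₂ : StmtTyping Γ' s₂ Γ'') : StmtTyping Γ (.seq s₁ s₂) Γ''
  | asgn {Γ : Ctx S} {x : S.Var} {e : Expr S} {τ : S.Ty} (h : ExprTyping Γ e τ) :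
      StmtTyping Γ (.asgn x e) (Γ.extend x τ)
  | ite {Γ Γ' : Ctx S} {e : Expr S} {s₁ s₂ : Stmt S} (h : ExprTyping Γ e S.boolTy)
      (h₁ : StmtTyping Γ s₁ Γ') (h₂ : StmtTyping Γ s₂ Γ') : StmtTyping Γ (.ite e s₁ s₂) Γ'
  | while {Γ : Ctx S} {e : Expr S} {s : Stmt S} (h : ExprTyping Γ e S.boolTy)
      (h₁ : StmtTyping Γ s Γ) : StmtTyping Γ (.while e s) Γ
  | sub {Γ Γ' Γ'' : Ctx S} {s : Stmt S} (h : StmtTyping Γ s Γ') (hsub : Γ''.Sub Γ') :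
      StmtTyping Γ s Γ''

/-- Derivations of `⊢ main(x₁ : τ₁, …, xₖ : τₖ) : τ {s}`. -/
structure ProgTyping (p : Program S) : Type u where
  ctx : Ctx S
  body : StmtTyping (Ctx.ofParams p.params) p.body ctx
  ret : ctx S.retvar = some p.retTy

/-! ### Operational semantics of SIMPLE -/

/-- Evaluation contexts: the value of each (defined) variable. -/
abbrev Env (S : Signature.{u}) : Type u := S.Var → Option (Value S)

/-- The value `⟦e⟧(E)` of an expression, `none` where it is undefined. -/
def Expr.eval (E : Env S) : Expr S → Option (Value S)
  | .var x => E x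
  | .op o args => liftOp o fun i => (args i).eval E

/-- `Exec s E E'`: started in `E`, the statement `s` terminates in `E'`, i.e. `⟦s⟧(E) = E'`. -/
inductive Exec : Stmt S → Env S → Env S → Prop
  | seq {s₁ s₂ : Stmt S} {E E' E'' : Env S} :
      Exec s₁ E E' → Exec s₂ E' E'' → Exec (.seq s₁ s₂) E E''
  | asgn {x : S.Var} {e : Expr S} {E : Env S} {v : Value S} :
      e.eval E = some v → Exec (.asgn x e) E (Function.update E x (some v))
  | ite_true {e : Expr S} {s₁ s₂ : Stmt S} {E E' : Env S} :
      e.eval E = some (ofBool true) → Exec s₁ E E' → Exec (.ite e s₁ s₂) E E'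
  | ite_false {e : Expr S} {s₁ s₂ : Stmt S} {E E' : Env S} :
      e.eval E = some (ofBool false) → Exec s₂ E E' → Exec (.ite e s₁ s₂) E E'
  | while_true {e : Expr S} {s : Stmt S} {E E' E'' : Env S} :
      e.eval E = some (ofBool true) → Exec s E E' → Exec (.while e s) E' E'' →
      Exec (.while e s) E E''
  | while_false {e : Expr S} {s : Stmt S} {E : Env S} :
      e.eval E = some (ofBool false) → Exec (.while e s) E E

/-- `⟦main⟧(E) = v`: the program terminates when started in `E`, and returns `v`. -/
def Program.Evaluates (p : Program S) (E : Env S) (v : Value S) : Prop :=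
  ∃ E', Exec p.body E E' ∧ E' S.retvar = some v

/-! ### Program expression graphs -/

/-- Values flowing through a PEG: values of the language, and natural numbers (the results of
`pass` nodes). -/
inductive PegVal (S : Signature.{u}) : Type u
  | val (v : Value S) : PegVal S
  | nat (k : ℕ) : PegVal S

/-- Loop iteration indices. A loop identifier is the nesting depth of the loop. -/
abbrev Idx : Type := ℕ → ℕ

/-- Loop-lifted, `⊥`-lifted values; `none` is `⊥`. -/
abbrev Lifted (S : Signature.{u}) : Type u := Idx → Option (PegVal S)

/-- A semantic function together with its arguments, taken from `X`: the primitive functions, and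
the domain functions, which are negation, the operations of the language and all constants. -/
inductive FnApp (S : Signature.{u}) (X : Type u) : Type u
  | phi (cond t f : X) : FnApp S X
  | theta (l : ℕ) (base loop : X) : FnApp S X
  | eval (l : ℕ) (loop idx : X) : FnApp S X
  | pass (l : ℕ) (cond : X) : FnApp S X
  | not (x : X) : FnApp S X
  | op (o : S.Op) (args : Fin (S.arity o) → X) : FnApp S X
  | const (v : Value S) : FnApp S X

/-- The label of a PEG node together with its children, taken from `X`: the label is either a
semantic function or `param(x)`; a parameter node has no children. -/
inductive Cell (S : Signature.{u}) (X : Type u) : Type u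
  | fn (f : FnApp S X) : Cell S X
  | param (x : S.Var) : Cell S X

def FnApp.map {X Y : Type u} (g : X → Y) : FnApp S X → FnApp S Y
  | .phi c t f => .phi (g c) (g t) (g f)
  | .theta l b n => .theta l (g b) (g n)
  | .eval l n k => .eval l (g n) (g k)
  | .pass l c => .pass l (g c)
  | .not x => .not (g x)
  | .op o args => .op o fun i => g (args i)
  | .const v => .const v

def Cell.map {X Y : Type u} (g : X → Y) : Cell S X → Cell S Y
  | .fn f => .fn (f.map g)
  | .param x => .param x

/-- A PEG with node set `N`: each node is mapped to its label and the list of its children. -/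
abbrev Peg (S : Signature.{u}) (N : Type u) : Type u := N → Cell S N

/-- The substitution `G[x ↦ c]` replaces each node labeled `param(x)` by the constant node `c`. -/
def Peg.subst {N : Type u} (G : Peg S N) (x : S.Var) (c : Value S) : Peg S N := fun n =>
  match G n with
  | .fn f => .fn f
  | .param y => if y = x then .fn (.const c) else .param y

/-- The iterated substitution `G[x₁ ↦ c₁] ⋯ [xₖ ↦ cₖ]`. -/
def Peg.substs {N : Type u} (G : Peg S N) (l : List (S.Var × Value S)) : Peg S N :=
  l.foldl (fun H b => H.subst b.1 b.2) G

open Classical in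
/-- Once a value is undefined at an iteration of loop `l`, it stays undefined. -/
def monotonize (l : ℕ) (value : Lifted S) : Lifted S := fun i =>
  if ∃ j < i l, value (Function.update i l j) = none then none else value i

open Classical in
def semPhi (cond t f : Lifted S) : Lifted S := fun i =>
  if cond i = some (.val (ofBool true)) then t i
  else if cond i = some (.val (ofBool false)) then f i
  else none

def semTheta (l : ℕ) (base loop : Lifted S) : Lifted S := fun i =>
  if i l = 0 then base i else loop (Function.update i l (i l - 1))

def semEval (l : ℕ) (loop idx : Lifted S) : Lifted S := fun i =>
  match idx i with
  | some (.nat k) => monotonize l loop (Function.update i l k)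
  | _ => none

open Classical in
def semPass (l : ℕ) (cond : Lifted S) : Lifted S := fun i =>
  if h : ∃ k : ℕ, monotonize l cond (Function.update i l k) = some (.val (ofBool true)) then
    some (.nat (Nat.find h))
  else none

open Classical in
def semNot (x : Lifted S) : Lifted S := fun i =>
  if x i = some (.val (ofBool true)) then some (.val (ofBool false))
  else if x i = some (.val (ofBool false)) then some (.val (ofBool true))
  else none

/-- A PEG value as a value of the language (natural numbers produced by `pass` are not). -/
def PegVal.toValue : PegVal S → Option (Value S)
  | .val v => some v
  | .nat _ => none

/-- The meaning of the semantic functions. -/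
def FnApp.sem : FnApp S (Lifted S) → Lifted S
  | .phi c t f => semPhi c t f
  | .theta l b n => semTheta l b n
  | .eval l n k => semEval l n k
  | .pass l c => semPass l c
  | .not x => semNot x
  | .op o args => fun i => (liftOp o fun j => (args j i).bind PegVal.toValue).map .val
  | .const v => fun _ => some (.val v)

/-- `V` solves the recursive equations `⟦n⟧ = L(n)(⟦C(n)⟧)` of the PEG `G`. There is no equation
for a parameter node, so that uniqueness of `V` fails as long as a parameter node is left. -/
def Peg.IsSemantics {N : Type u} (G : Peg S N) (V : N → Lifted S) : Prop :=
  ∀ n f, G n = .fn f → V n = (f.map V).sem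

/-- `⟦n⟧(i) = v` for the node `n` of the PEG `G`: the recursive equations of `G` have a unique
solution `⟦·⟧`, and `v` (which is not `⊥`) is its value at the node `n` and the index `i`. -/
def Peg.EvaluatesTo {N : Type u} (G : Peg S N) (n : N) (i : Idx) (v : Value S) : Prop :=
  ∃ V : N → Lifted S, G.IsSemantics V ∧ (∀ V', G.IsSemantics V' → V' = V) ∧
    V n i = some (.val v)

/-! ### The type-directed translation

The translation is a function of a typing derivation and of a node context `Ψ`. The nodes that
already exist form a type `M`; fresh nodes are obtained by adjoining a new type `N` of nodes. -/

/-- The result of a translation step that starts from the existing nodes `M`: a type `N` of newly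
created nodes, with their labels and children, and a node for each element of `D`. -/
structure Frag (S : Signature.{u}) (M D : Type u) where
  N : Type u
  cell : N → Cell S (M ⊕ N)
  out : D → M ⊕ N

/-- New nodes for `op(e₁, …, eₖ)`: the root, and the new nodes of the arguments. -/
inductive OpNode {k : ℕ} (A : Fin k → Type u) : Type u
  | root : OpNode A
  | arg (i : Fin k) (n : A i) : OpNode A

/-- New nodes for a conditional: those of the guard and of the two branches, and a `φ` node for
each variable. -/
inductive IteNode (C A B X : Type u) : Type u
  | cond (n : C) : IteNode C A B X
  | thenB (n : A) : IteNode C A B X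
  | elseB (n : B) : IteNode C A B X
  | phi (x : X) : IteNode C A B X

/-- New nodes for a loop: those of the guard and of the body, the break condition, a `pass` node,
and a `θ` node and an `eval` node for each variable. -/
inductive WhileNode (C B X : Type u) : Type u
  | cond (n : C) : WhileNode C B X
  | body (n : B) : WhileNode C B X
  | not : WhileNode C B X
  | pass : WhileNode C B X
  | theta (x : X) : WhileNode C B X
  | eval (x : X) : WhileNode C B X

theorem Ctx.dom_of_extend {Γ : Ctx S} {x : S.Var} {τ : S.Ty} (y : (Γ.extend x τ).Dom)
    (h : y.1 ≠ x) : Γ y.1 ≠ none := by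
  have := y.2
  simpa [Ctx.extend, Function.update_of_ne h] using this

theorem Ctx.Sub.dom {Γ'' Γ' : Ctx S} (h : Γ''.Sub Γ') (x : Γ''.Dom) : Γ' x.1 ≠ none := by
  obtain ⟨τ, hτ⟩ := Option.ne_none_iff_exists'.mp x.2
  simp [h x.1 τ hτ]

/-- A variable creates no node. -/
def Frag.ofNode {M : Type u} (m : M) : Frag S M PUnit.{u + 1} where
  N := PEmpty
  cell := PEmpty.elim
  out := fun _ => .inl m

/-- The node `op(n₁, …, nₖ)`, where `nᵢ` is the result of `r i`. -/
def Frag.op {M : Type u} (o : S.Op) (r : Fin (S.arity o) → Frag S M PUnit.{u + 1}) :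
    Frag S M PUnit.{u + 1} where
  N := OpNode fun i => (r i).N
  cell
    | .root => .fn (.op o fun i => ((r i).out ⟨⟩).map id fun n => .arg i n)
    | .arg i n => ((r i).cell n).map (Sum.map id fun n => .arg i n)
  out := fun _ => .inr .root

/-- Two consecutive steps; the nodes created by the first one exist for the second one. -/
def Frag.seq {M D₁ D₂ : Type u} (r₁ : Frag S M D₁) (r₂ : Frag S (M ⊕ r₁.N) D₂) :
    Frag S M D₂ where
  N := r₁.N ⊕ r₂.N
  cell
    | .inl n => (r₁.cell n).map (Sum.map id Sum.inl)
    | .inr n => (r₂.cell n).map (Equiv.sumAssoc M r₁.N r₂.N)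
  out := fun x => Equiv.sumAssoc M r₁.N r₂.N (r₂.out x)

/-- The nodes `φ(n, n_(x,1), n_(x,2))` for `x` in `X`. -/
def Frag.ite {M X : Type u} (rc : Frag S M PUnit.{u + 1}) (r₁ r₂ : Frag S M X) :
    Frag S M X where
  N := IteNode rc.N r₁.N r₂.N X
  cell
    | .cond n => (rc.cell n).map (Sum.map id .cond)
    | .thenB n => (r₁.cell n).map (Sum.map id .thenB)
    | .elseB n => (r₂.cell n).map (Sum.map id .elseB)
    | .phi x => .fn (.phi ((rc.out ⟨⟩).map id .cond) ((r₁.out x).map id .thenB)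
        ((r₂.out x).map id .elseB))
  out := fun x => .inr (.phi x)

/-- The nodes `eval(v_x, pass(¬ n))` for `x` in `X`, with `v_x` unified with `θ(n_x, n'_x)`.
The guard (with result `n`) and the body (with results `n'_x`) are given over the temporary nodes
`v_x`, which form the type `X`; the node `n_x` is `Ψ x`. -/
def Frag.while {M X : Type u} (l : ℕ) (Ψ : X → M) (rc : Frag S X PUnit.{u + 1})
    (rb : Frag S X X) : Frag S M X where
  N := WhileNode rc.N rb.N X
  cell
    | .cond n => (rc.cell n).map fun z => .inr (z.elim .theta .cond)
    | .body n => (rb.cell n).map fun z => .inr (z.elim .theta .body)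
    | .not => .fn (.not (.inr ((rc.out ⟨⟩).elim .theta .cond)))
    | .pass => .fn (.pass l (.inr .not))
    | .theta x => .fn (.theta l (.inl (Ψ x)) (.inr ((rb.out x).elim .theta .body)))
    | .eval x => .fn (.eval l (.inr (.theta x)) (.inr .pass))
  out := fun x => .inr (.eval x)

/-- The node context `(Ψ, x : n)`, where `n` is the result of `r`. -/
def Frag.asgn {M : Type u} {Γ : Ctx S} (Ψ : Γ.Dom → M) (x : S.Var) (τ : S.Ty)
    (r : Frag S M PUnit.{u + 1}) : Frag S M (Γ.extend x τ).Dom where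
  N := r.N
  cell := r.cell
  out := fun y => if h : y.1 = x then r.out ⟨⟩ else .inl (Ψ ⟨y.1, Ctx.dom_of_extend y h⟩)

/-- The restriction of the resulting node context to `Γ''`. -/
def Frag.sub {M : Type u} {Γ' Γ'' : Ctx S} (h : Γ''.Sub Γ') (r : Frag S M Γ'.Dom) :
    Frag S M Γ''.Dom where
  N := r.N
  cell := r.cell
  out := fun x => r.out ⟨x.1, h.dom x⟩

theorem Ctx.dom_of_eq {Γ : Ctx S} {x : S.Var} {τ : S.Ty} (h : Γ x = some τ) : Γ x ≠ none := by
  simp [h]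

/-- The translation `Γ ⊢ e : τ ▷ Ψ ⊢ n` of expressions; the resulting node `n` is the field
`out`. -/
def ExprTyping.trans {Γ : Ctx S} {M : Type u} (Ψ : Γ.Dom → M) {e : Expr S} {τ : S.Ty} :
    ExprTyping Γ e τ → Frag S M PUnit.{u + 1}
  | .var x _ h => .ofNode (Ψ ⟨x, Ctx.dom_of_eq h⟩)
  | .op o _ h => .op o fun i => (h i).trans Ψ

/-- The translation `Γ ⊢ s : Γ' ▷ Ψ →_ℓ Ψ'` of statements at loop depth `ℓ`; the resulting node
context `Ψ'` is the field `out`. -/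
def StmtTyping.trans {Γ Γ' : Ctx S} {s : Stmt S} (h : StmtTyping Γ s Γ') (l : ℕ)
    {M : Type u} (Ψ : Γ.Dom → M) : Frag S M Γ'.Dom :=
  match h with
  | .seq h₁ h₂ => .seq (h₁.trans l Ψ) (h₂.trans l (h₁.trans l Ψ).out)
  | .asgn (x := x) (τ := τ) he => .asgn Ψ x τ (he.trans Ψ)
  | .ite he h₁ h₂ => .ite (he.trans Ψ) (h₁.trans l Ψ) (h₂.trans l Ψ)
  | .while he hb => .while (l + 1) Ψ (he.trans id) (hb.trans (l + 1) id)
  | .sub h' hsub => .sub hsub (h'.trans l Ψ)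

section Prog

variable {p : Program S} (D : ProgTyping p)

/-- The translation of the body at loop depth `0`; the existing nodes are the parameter nodes, one
for each parameter of the program. -/
def ProgTyping.bodyTrans : Frag S (Ctx.ofParams p.params).Dom D.ctx.Dom :=
  D.body.trans 0 id

/-- The nodes of the translated program. -/
abbrev ProgTyping.Node : Type u := (Ctx.ofParams p.params).Dom ⊕ D.bodyTrans.N

/-- The PEG created by the translation `⊢ p ▷ n`. -/
def ProgTyping.peg : Peg S D.Node
  | .inl x => .param x.1
  | .inr n => D.bodyTrans.cell n

/-- The node `n` with `⊢ p ▷ n`: the node of `retvar` after the body. -/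
def ProgTyping.root : D.Node := D.bodyTrans.out ⟨S.retvar, by simp [D.ret]⟩

end Prog

end Simple

end

namespace Simple

variable {S : Signature.{u}}

/-! ### Relabelling children -/

/-! Two facts are needed: the equations of the substituted PEG have exactly one solution, and that
solution simulates the execution.

The graph is cyclic, but its equations relate pairs (node, index), and dependency between such pairs
is well-founded: a cycle runs through a `θ` node, which reads its loop child one iteration earlier.
`StmtTyping.progress` proves this by induction on the typing derivation, with an inner induction on
the iteration number. Well-founded recursion and induction then give existence
(`Peg.exists_isSemantics`) and uniqueness (`Peg.IsSemantics.unique`).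

The simulation is `StmtTyping.trans_correct`. At depth `l` the nodes hold the values of the
variables at all indices of a set `J` closed under changing the counters deeper than `l`. For a
loop, `J` is cut into slices by the counter `l + 1`; on slice `k` the `θ` nodes hold the environment
after `k` iterations. If the loop exits after `m` iterations, the negated guard is false before `m`
and true at `m`, so `pass` returns `m` and `eval` reads the `θ` nodes there; `mon` is harmless since
everything earlier is defined.

Both inductions pass to subderivations because their hypotheses are local to new nodes and pull back
along embeddings of fragments. -/

theorem FnApp.map_map {X Y Z : Type u} (g : Y → Z) (h : X → Y) (f : FnApp S X) :
    (f.map h).map g = f.map fun x => g (h x) := by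
  cases f <;> rfl

/-- `f.Needs i m j`: the value of `f` at the index `i` may depend on the value of the child `m` at
the index `j`. -/
def FnApp.Needs {X : Type u} (i : Idx) (m : X) (j : Idx) : FnApp S X → Prop
  | .phi c t f => j = i ∧ (m = c ∨ m = t ∨ m = f)
  | .theta l b n =>
    (i l = 0 ∧ m = b ∧ j = i) ∨ (i l ≠ 0 ∧ m = n ∧ j = Function.update i l (i l - 1))
  | .eval l n k => (m = k ∧ j = i) ∨ (m = n ∧ ∃ a, j = Function.update i l a)
  | .pass l c => m = c ∧ ∃ a, j = Function.update i l a
  | .not x => m = x ∧ j = i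
  | .op _ args => j = i ∧ ∃ a, m = args a
  | .const _ => False

theorem FnApp.Needs.of_map {X Y : Type u} {g : X → Y} {f : FnApp S X} {i j : Idx} {m : Y}
    (h : (f.map g).Needs i m j) : ∃ x, g x = m ∧ f.Needs i x j := by
  cases f <;> simp only [FnApp.map, FnApp.Needs] at h ⊢ <;> grind

theorem monotonize_congr {l : ℕ} {u v : Lifted S} {i : Idx}
    (h : ∀ a, u (Function.update i l a) = v (Function.update i l a)) (k : ℕ) :
    monotonize l u (Function.update i l k) = monotonize l v (Function.update i l k) := by
  simp [monotonize, h]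

-- `Needs` over-approximates what a semantic function reads. For `eval` and `pass` a whole line in
-- direction `l` is allowed, since `mon` and the search for the least iteration range along it; for
-- `θ` it is exact, which is what makes loops well-founded.
open Classical in
theorem FnApp.sem_congr {X : Type u} {V W : X → Lifted S} {f : FnApp S X} {i : Idx}
    (h : ∀ m j, f.Needs i m j → V m j = W m j) : (f.map V).sem i = (f.map W).sem i := by
  cases f with
  | phi c t e =>
    simp only [FnApp.map, FnApp.sem, semPhi]
    rw [h c i (by simp [Needs]), h t i (by simp [Needs]), h e i (by simp [Needs])]
  | theta l b n =>
    by_cases hi : i l = 0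
    · simp [FnApp.map, FnApp.sem, semTheta, hi, h b i (by simp [Needs, hi])]
    · simp [FnApp.map, FnApp.sem, semTheta, hi, h n _ (.inr ⟨hi, rfl, rfl⟩)]
  | eval l n k =>
    simp only [FnApp.map, FnApp.sem, semEval, h k i (by simp [Needs])]
    have := monotonize_congr (l := l) (u := V n) (v := W n) (i := i)
      fun a => h _ _ (.inr ⟨rfl, a, rfl⟩)
    simp only [this]
  | pass l c =>
    have := monotonize_congr (l := l) (u := V c) (v := W c) (i := i)
      fun a => h _ _ ⟨rfl, a, rfl⟩
    -- `pass` depends only on the sequence of monotonized values, so the sequence is replaced as a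
    -- whole instead of rewriting inside the dependent `Nat.find`.
    exact congrArg (fun u : ℕ → Option (PegVal S) =>
      if h : ∃ k, u k = some (.val (ofBool true)) then
        some (PegVal.nat (S := S) (Nat.find h)) else none)
      (funext this)
  | not x =>
    simp only [FnApp.map, FnApp.sem, semNot]
    rw [h x i (by simp [Needs])]
  | op o args => simp [FnApp.map, FnApp.sem, h _ i ⟨rfl, _, rfl⟩]
  | const v => rfl

/-! ### Unique solvability of the recursive equations -/

/-- The value of `p.1` at the index `p.2` may depend on that of `q.1` at `q.2`. -/
def Peg.Dep {N : Type u} (G : Peg S N) (q p : N × Idx) : Prop :=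
  ∃ f, G p.1 = .fn f ∧ f.Needs p.2 q.1 q.2

open Classical in
theorem Peg.exists_isSemantics {N : Type u} (G : Peg S N) (wf : WellFounded G.Dep) :
    ∃ V, G.IsSemantics V := by
  let F : (p : N × Idx) → ((q : N × Idx) → G.Dep q p → Option (PegVal S)) → Option (PegVal S) :=
    fun p rec =>
      match G p.1 with
      | .fn f => (f.map fun m j => if h : G.Dep (m, j) p then rec (m, j) h else none).sem p.2
      | .param _ => none
  refine ⟨fun n i => wf.fix F (n, i), fun n f hf => funext fun i => ?_⟩
  refine (wf.fix_eq F (n, i)).trans ?_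
  simp only [F, hf]
  refine FnApp.sem_congr fun m j hm => ?_
  exact dif_pos ⟨f, hf, hm⟩

theorem Peg.IsSemantics.unique {N : Type u} {G : Peg S N} (wf : WellFounded G.Dep)
    (hG : ∀ n, ∃ f, G n = .fn f) {V W : N → Lifted S} (hV : G.IsSemantics V)
    (hW : G.IsSemantics W) : V = W := by
  have key : ∀ p : N × Idx, V p.1 p.2 = W p.1 p.2 := fun p => by
    induction p using wf.induction with
    | _ p ih =>
      obtain ⟨f, hf⟩ := hG p.1
      rw [hV _ f hf, hW _ f hf]
      exact FnApp.sem_congr fun m j hm => ih (m, j) ⟨f, hf, hm⟩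
  exact funext fun n => funext fun i => key (n, i)

/-! ### Fragments -/

/-- The indices in `J` stay in `J` when entries at depths greater than `l` are changed. -/
def FreeAbove (l : ℕ) (J : Set Idx) : Prop :=
  ∀ i ∈ J, ∀ m, l < m → ∀ a, Function.update i m a ∈ J

/-- Fixing the counter of a loop at depth `l + 1` still leaves all deeper counters free, as its
body, translated at depth `l + 1`, requires. -/
theorem FreeAbove.slice {l : ℕ} {J : Set Idx} (hJ : FreeAbove l J) (k : ℕ) :
    FreeAbove (l + 1) {i | i ∈ J ∧ i (l + 1) = k} := fun i hi m hm a =>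
  ⟨hJ i hi.1 m (by omega) a, by rw [Function.update_of_ne (by omega)]; exact hi.2⟩

/-- No new node is a parameter node. -/
def Frag.ParamFree {M D : Type u} (r : Frag S M D) : Prop := ∀ n, ∃ f, r.cell n = .fn f

/-- `A` holds for a new node at an index as soon as it holds wherever the node depends on. -/
def Frag.Progressive {M D : Type u} (r : Frag S M D) (A : M ⊕ r.N → Idx → Prop) : Prop :=
  ∀ n f i, r.cell n = .fn f → (∀ m j, f.Needs i m j → A m j) → A (.inr n) i

/-- `W` solves the recursive equations of the new nodes. -/
def Frag.Solves {M D : Type u} (r : Frag S M D) (W : M ⊕ r.N → Lifted S) : Prop :=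
  ∀ n f, r.cell n = .fn f → W (.inr n) = (f.map W).sem

theorem Cell.map_eq_fn {X Y : Type u} {g : X → Y} {c : Cell S X} {f : FnApp S X}
    (h : c = .fn f) : c.map g = .fn (f.map g) := by
  subst h; rfl

/-- The fragment `r` is part of the fragment `r'`, with its nodes renamed by `g`. -/
def Frag.Embeds {M M' D D' : Type u} (r : Frag S M D) (r' : Frag S M' D')
    (e : r.N → r'.N) (g : M ⊕ r.N → M' ⊕ r'.N) : Prop :=
  ∀ n, g (.inr n) = .inr (e n) ∧ r'.cell (e n) = (r.cell n).map g

/-- Together with `Frag.Solves.comap`, this lets an induction hypothesis about a subderivation be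
applied inside the larger fragment. -/
theorem Frag.Progressive.comap {M M' D D' : Type u} {r : Frag S M D} {r' : Frag S M' D'}
    {e : r.N → r'.N} {g : M ⊕ r.N → M' ⊕ r'.N} (hg : r.Embeds r' e g)
    {A : M' ⊕ r'.N → Idx → Prop} (hA : r'.Progressive A) :
    r.Progressive fun z => A (g z) := by
  intro n f i hf h
  simp only [(hg n).1]
  refine hA _ _ i ((hg n).2.trans (Cell.map_eq_fn hf)) fun m j hm => ?_
  obtain ⟨x, rfl, hx⟩ := hm.of_map
  exact h x j hx

theorem Frag.Solves.comap {M M' D D' : Type u} {r : Frag S M D} {r' : Frag S M' D'}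
    {e : r.N → r'.N} {g : M ⊕ r.N → M' ⊕ r'.N} (hg : r.Embeds r' e g)
    {W : M' ⊕ r'.N → Lifted S} (hW : r'.Solves W) :
    r.Solves fun z => W (g z) := by
  intro n f hf
  simp only [(hg n).1]
  rw [hW _ _ ((hg n).2.trans (Cell.map_eq_fn hf)), FnApp.map_map]

theorem Frag.Embeds.exists_fn {M M' D D' : Type u} {r : Frag S M D} {r' : Frag S M' D'}
    {e : r.N → r'.N} {g : M ⊕ r.N → M' ⊕ r'.N} (hg : r.Embeds r' e g) (hr : r.ParamFree)
    (n : r.N) : ∃ f, r'.cell (e n) = .fn f :=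
  (hr n).elim fun _ hf => ⟨_, (hg n).2.trans (Cell.map_eq_fn hf)⟩

section Embeddings

variable {M X : Type u}

theorem Frag.embeds_op {o : S.Op} (r : Fin (S.arity o) → Frag S M PUnit.{u + 1})
    (i : Fin (S.arity o)) :
    (r i).Embeds (Frag.op o r) (fun n => .arg i n) (Sum.map id fun n => .arg i n) :=
  fun _ => ⟨rfl, rfl⟩

theorem Frag.embeds_seq_left {D₁ D₂ : Type u} (r₁ : Frag S M D₁) (r₂ : Frag S (M ⊕ r₁.N) D₂) :
    r₁.Embeds (Frag.seq r₁ r₂) Sum.inl (Sum.map id Sum.inl) :=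
  fun _ => ⟨rfl, rfl⟩

theorem Frag.embeds_seq_right {D₁ D₂ : Type u} (r₁ : Frag S M D₁)
    (r₂ : Frag S (M ⊕ r₁.N) D₂) :
    r₂.Embeds (Frag.seq r₁ r₂) Sum.inr (Equiv.sumAssoc M r₁.N r₂.N) :=
  fun _ => ⟨rfl, rfl⟩

theorem Frag.embeds_ite_cond (rc : Frag S M PUnit.{u + 1}) (r₁ r₂ : Frag S M X) :
    rc.Embeds (Frag.ite rc r₁ r₂) .cond (Sum.map id .cond) :=
  fun _ => ⟨rfl, rfl⟩

theorem Frag.embeds_ite_then (rc : Frag S M PUnit.{u + 1}) (r₁ r₂ : Frag S M X) :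
    r₁.Embeds (Frag.ite rc r₁ r₂) .thenB (Sum.map id .thenB) :=
  fun _ => ⟨rfl, rfl⟩

theorem Frag.embeds_ite_else (rc : Frag S M PUnit.{u + 1}) (r₁ r₂ : Frag S M X) :
    r₂.Embeds (Frag.ite rc r₁ r₂) .elseB (Sum.map id .elseB) :=
  fun _ => ⟨rfl, rfl⟩

theorem Frag.embeds_while_cond (l : ℕ) (Ψ : X → M) (rc : Frag S X PUnit.{u + 1})
    (rb : Frag S X X) :
    rc.Embeds (Frag.while l Ψ rc rb) .cond fun z => .inr (z.elim .theta .cond) :=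
  fun _ => ⟨rfl, rfl⟩

theorem Frag.embeds_while_body (l : ℕ) (Ψ : X → M) (rc : Frag S X PUnit.{u + 1})
    (rb : Frag S X X) :
    rb.Embeds (Frag.while l Ψ rc rb) .body fun z => .inr (z.elim .theta .body) :=
  fun _ => ⟨rfl, rfl⟩

end Embeddings

/-! ### The translation creates no parameter nodes -/

theorem ExprTyping.paramFree_trans {Γ : Ctx S} {M : Type u} (Ψ : Γ.Dom → M) {e : Expr S}
    {τ : S.Ty} (h : ExprTyping Γ e τ) : (h.trans Ψ).ParamFree := by
  induction h with
  | var x τ h => exact fun n => PEmpty.elim n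
  | op o args h ih =>
    rintro (_ | ⟨i, n⟩)
    · exact ⟨_, rfl⟩
    · exact (Frag.embeds_op (fun i => (h i).trans Ψ) i).exists_fn (ih i) n

theorem StmtTyping.paramFree_trans {Γ Γ' : Ctx S} {s : Stmt S} (h : StmtTyping Γ s Γ') (l : ℕ)
    {M : Type u} (Ψ : Γ.Dom → M) : (h.trans l Ψ).ParamFree := by
  induction h generalizing l M with
  | seq h₁ h₂ ih₁ ih₂ =>
    rintro (n | n)
    · exact (Frag.embeds_seq_left _ _).exists_fn (ih₁ l Ψ) n
    · exact (Frag.embeds_seq_right _ _).exists_fn (ih₂ l _) n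
  | asgn he => exact he.paramFree_trans Ψ
  | ite he h₁ h₂ ih₁ ih₂ =>
    rintro (n | n | n | x)
    · exact (Frag.embeds_ite_cond _ _ _).exists_fn (he.paramFree_trans Ψ) n
    · exact (Frag.embeds_ite_then _ _ _).exists_fn (ih₁ l Ψ) n
    · exact (Frag.embeds_ite_else _ _ _).exists_fn (ih₂ l Ψ) n
    · exact ⟨_, rfl⟩
  | sub h' hsub ih => exact ih l Ψ
  | _ he hb ih =>
    rintro (n | n | _ | _ | x | x)
    · exact (Frag.embeds_while_cond _ _ _ _).exists_fn (he.paramFree_trans id) n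
    · exact (Frag.embeds_while_body _ _ _ _).exists_fn (ih (l + 1) id) n
    all_goals exact ⟨_, rfl⟩

/-! ### The dependencies created by the translation are well-founded -/

/-- Expressions yield only operation nodes, which read their children at the same index, so a single
index suffices. -/
theorem ExprTyping.progress {Γ : Ctx S} {M : Type u} (Ψ : Γ.Dom → M) {e : Expr S} {τ : S.Ty}
    (h : ExprTyping Γ e τ) {A : M ⊕ (h.trans Ψ).N → Idx → Prop}
    (hA : (h.trans Ψ).Progressive A) {i : Idx} (hM : ∀ m, A (.inl m) i)
    (n : M ⊕ (h.trans Ψ).N) : A n i := by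
  induction h with
  | var x τ h =>
    rcases n with m | n
    exacts [hM m, PEmpty.elim n]
  | op o args h ih =>
    have args_hold (a) (n : M ⊕ ((h a).trans Ψ).N) : A (n.map id fun n => .arg a n) i :=
      ih a (hA.comap (Frag.embeds_op _ a)) hM n
    rcases n with m | _ | ⟨a, n⟩
    · exact hM m
    · refine hA _ _ i rfl ?_
      rintro _ _ ⟨rfl, a, rfl⟩
      exact args_hold a _
    · exact args_hold a (.inr n)

/-- To be applied with `A` the accessibility of (node, index). A set `J` of indices is needed, since
`pass` and `eval` read all iterations of their loop. -/
theorem StmtTyping.progress {Γ Γ' : Ctx S} {s : Stmt S} (h : StmtTyping Γ s Γ') (l : ℕ)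
    {M : Type u} (Ψ : Γ.Dom → M) {A : M ⊕ (h.trans l Ψ).N → Idx → Prop}
    (hA : (h.trans l Ψ).Progressive A) {J : Set Idx} (hJ : FreeAbove l J)
    (hM : ∀ m, ∀ i ∈ J, A (.inl m) i) (n : M ⊕ (h.trans l Ψ).N) : ∀ i ∈ J, A n i := by
  induction h generalizing l M J with
  | seq h₁ h₂ ih₁ ih₂ =>
    have H₁ := ih₁ l Ψ (hA.comap (Frag.embeds_seq_left _ _)) hJ hM
    have H₂ := ih₂ l _ (hA.comap (Frag.embeds_seq_right _ _)) hJ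
      (by rintro (m | m); exacts [hM m, H₁ (.inr m)])
    rcases n with m | n | n
    exacts [hM m, H₁ (.inr n), H₂ (.inr n)]
  | asgn he => exact fun i hi => he.progress Ψ hA (fun m => hM m i hi) n
  | ite he h₁ h₂ ih₁ ih₂ =>
    have Hc := fun i hi => he.progress Ψ (hA.comap (Frag.embeds_ite_cond _ _ _))
      (i := i) fun m => hM m i hi
    have H₁ := ih₁ l Ψ (hA.comap (Frag.embeds_ite_then _ _ _)) hJ hM
    have H₂ := ih₂ l Ψ (hA.comap (Frag.embeds_ite_else _ _ _)) hJ hM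
    rcases n with m | n | n | n | x
    · exact hM m
    · exact fun i hi => Hc i hi (.inr n)
    · exact H₁ (.inr n)
    · exact H₂ (.inr n)
    · intro i hi
      refine hA _ _ i rfl ?_
      rintro _ _ ⟨rfl, rfl | rfl | rfl⟩
      exacts [Hc _ hi _, H₁ _ _ hi, H₂ _ _ hi]
  | sub h' hsub ih => exact ih l Ψ hA hJ hM n
  | _ he hb ih =>
    -- Induction on the iteration breaks the cycle: on slice `0` a `θ` node reads only its base, and
    -- on slice `k + 1` only the body on slice `k`, whose inputs are the `θ` nodes on slice `k`.
    have Hθ (k : ℕ) : ∀ x, ∀ i ∈ {i | i ∈ J ∧ i (l + 1) = k}, A (.inr (.theta x)) i := by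
      induction k with
      | zero =>
        rintro x i ⟨hi, h0⟩
        refine hA _ _ i rfl ?_
        rintro _ _ (⟨-, rfl, rfl⟩ | ⟨h, -⟩)
        exacts [hM _ _ hi, absurd h0 h]
      | succ k ihk =>
        have Hb := ih (l + 1) id (hA.comap (Frag.embeds_while_body _ _ _ _)) (hJ.slice k) ihk
        rintro x i ⟨hi, hk⟩
        refine hA _ _ i rfl ?_
        rintro _ _ (⟨h, -⟩ | ⟨-, rfl, rfl⟩)
        · omega
        · exact Hb _ _ ⟨hJ i hi _ (by omega) _, by simp [hk]⟩
    have Hθ (x) (i) (hi : i ∈ J) : A (.inr (.theta x)) i := Hθ _ x i ⟨hi, rfl⟩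
    have Hb (i) (hi : i ∈ J) := fun z => ih (l + 1) id
      (hA.comap (Frag.embeds_while_body _ _ _ _)) (hJ.slice (i (l + 1)))
      (fun x i hi => Hθ x i hi.1) z i ⟨hi, rfl⟩
    have Hc := fun i hi => he.progress id (hA.comap (Frag.embeds_while_cond _ _ _ _))
      (i := i) fun x => Hθ x i hi
    have Hnot (i) (hi : i ∈ J) : A (.inr .not) i := by
      refine hA _ _ i rfl ?_
      rintro _ _ ⟨rfl, rfl⟩
      exact Hc _ hi _
    have Hpass (i) (hi : i ∈ J) : A (.inr .pass) i := by
      refine hA _ _ i rfl ?_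
      rintro _ _ ⟨rfl, a, rfl⟩
      exact Hnot _ (hJ i hi _ (by omega) a)
    rcases n with m | n | n | _ | _ | x | x
    · exact hM m
    · exact fun i hi => Hc i hi (.inr n)
    · exact fun i hi => Hb i hi (.inr n)
    · exact Hnot
    · exact Hpass
    · exact Hθ x
    · intro i hi
      refine hA _ _ i rfl ?_
      rintro _ _ (⟨rfl, rfl⟩ | ⟨rfl, a, rfl⟩)
      exacts [Hpass _ hi, Hθ _ _ (hJ i hi _ (by omega) a)]

/-! ### Correctness of the translation -/

/-- Both sides apply the same strict operations, so the equality includes the undefined case. -/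
theorem ExprTyping.trans_correct {Γ : Ctx S} {M : Type u} (Ψ : Γ.Dom → M) {e : Expr S}
    {τ : S.Ty} (h : ExprTyping Γ e τ) {W : M ⊕ (h.trans Ψ).N → Lifted S}
    (hW : (h.trans Ψ).Solves W) {E : Env S} {i : Idx}
    (hE : ∀ x, W (.inl (Ψ x)) i = (E x.1).map .val) :
    W ((h.trans Ψ).out ⟨⟩) i = (e.eval E).map .val := by
  induction h with
  | var x τ h => exact hE ⟨x, _⟩
  | op o args h ih =>
    have H (a) : W ((((h a).trans Ψ).out ⟨⟩).map id fun n => .arg a n) i =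
        ((args a).eval E).map .val := ih a (hW.comap (Frag.embeds_op _ a)) hE
    refine (congrFun (hW OpNode.root _ rfl) i).trans ?_
    simp only [FnApp.map, FnApp.sem, Expr.eval]
    congr 2
    funext a
    refine (congrArg (Option.bind · PegVal.toValue) (H a)).trans ?_
    cases (args a).eval E <;> rfl

/-- At all indices in `J`, the nodes `ψ x` have the (defined) values that `E` gives to the
variables `x` of `Γ`. -/
def Represents {Γ : Ctx S} (J : Set Idx) (ψ : Γ.Dom → Lifted S) (E : Env S) : Prop :=
  ∀ x, ∃ v, E x.1 = some v ∧ ∀ i ∈ J, ψ x i = some (.val v)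

theorem Represents.map_val {Γ : Ctx S} {J : Set Idx} {ψ : Γ.Dom → Lifted S} {E : Env S}
    (h : Represents J ψ E) {i : Idx} (hi : i ∈ J) (x : Γ.Dom) :
    ψ x i = (E x.1).map .val := by
  obtain ⟨v, hv, hψ⟩ := h x
  rw [hv, hψ i hi]; rfl

theorem ofBool_injective : Function.Injective (ofBool : Bool → Value S) := by
  intro a b h
  simpa [ofBool] using h

theorem semNot_of_eq {x : Lifted S} {i : Idx} {b : Bool} (h : x i = some (.val (ofBool b))) :
    semNot x i = some (.val (ofBool !b)) := by
  have : (ofBool false : Value S) ≠ ofBool true := fun h => by simpa using ofBool_injective h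
  cases b <;> simp [semNot, h, this]

theorem semPhi_of_eq {c t f : Lifted S} {i : Idx} {b : Bool}
    (h : c i = some (.val (ofBool b))) : semPhi c t f i = if b then t i else f i := by
  have : (ofBool false : Value S) ≠ ofBool true := fun h => by simpa using ofBool_injective h
  cases b <;> simp [semPhi, h, this]

theorem monotonize_update {l : ℕ} {u : Lifted S} {i : Idx} {k : ℕ}
    (h : ∀ j < k, u (Function.update i l j) ≠ none) :
    monotonize l u (Function.update i l k) = u (Function.update i l k) := by
  refine if_neg ?_
  rintro ⟨j, hj, hn⟩
  simp only [Function.update_self, Function.update_idem] at hj hn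
  exact h j hj hn

/-- The earlier conditions are false but defined, so `mon` changes nothing up to `k`. -/
theorem semPass_eq {l : ℕ} {c : Lifted S} {i : Idx} {k : ℕ}
    (hlt : ∀ j < k, c (Function.update i l j) = some (.val (ofBool false)))
    (hk : c (Function.update i l k) = some (.val (ofBool true))) :
    semPass l c i = some (.nat k) := by
  classical
  have hm (j : ℕ) (hj : j ≤ k) :
      monotonize l c (Function.update i l j) = c (Function.update i l j) :=
    monotonize_update fun a ha => by simp [hlt a (by omega)]
  have ex : ∃ j, monotonize l c (Function.update i l j) = some (.val (ofBool true)) :=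
    ⟨k, (hm k le_rfl).trans hk⟩
  rw [semPass, dif_pos ex]
  congr 2
  refine (Nat.find_eq_iff ex).2 ⟨(hm k le_rfl).trans hk, fun j hj h => ?_⟩
  rw [hm j hj.le, hlt j hj] at h
  simpa using ofBool_injective (PegVal.val.inj (Option.some.inj h))

/-- A terminating loop, started in an environment `E` represented at iteration `k`, is left at
some iteration `m ≥ k`; all the environments from `k` to `m` are represented. -/
theorem Exec.exists_iteration {Γ : Ctx S} {e : Expr S} {s : Stmt S} {J : ℕ → Set Idx}
    {θ : Γ.Dom → Lifted S} {c : Lifted S}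
    (hc : ∀ k E, Represents (J k) θ E → ∀ i ∈ J k, c i = (e.eval E).map .val)
    (hs : ∀ k E E', Represents (J k) θ E → Exec s E E' → Represents (J (k + 1)) θ E')
    {t : Stmt S} {E E' : Env S} (hx : Exec t E E') (ht : t = .while e s) (k : ℕ)
    (hE : Represents (J k) θ E) :
    ∃ m, k ≤ m ∧ (∀ j, k ≤ j → j < m → (∃ E₁, Represents (J j) θ E₁) ∧
        ∀ i ∈ J j, c i = some (.val (ofBool true))) ∧
      (∀ i ∈ J m, c i = some (.val (ofBool false))) ∧ Represents (J m) θ E' := by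
  -- The iteration `k` varies because the rest of the run starts at `k + 1`.
  induction hx generalizing k with
  | seq | asgn | ite_true | ite_false => cases ht
  | while_true hb hx₁ _ _ ih =>
    cases ht
    obtain ⟨m, hkm, hlt, hm, hE'⟩ := ih rfl (k + 1) (hs k _ _ hE hx₁)
    refine ⟨m, by omega, fun j hkj hjm => ?_, hm, hE'⟩
    rcases hkj.eq_or_lt with rfl | hkj
    · exact ⟨⟨_, hE⟩, fun i hi => by rw [hc _ _ hE i hi, hb]; rfl⟩
    · exact hlt j hkj hjm
  | while_false hb =>
    cases ht
    exact ⟨k, le_rfl, fun j h₁ h₂ => by omega, fun i hi => by rw [hc _ _ hE i hi, hb]; rfl, hE⟩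

/-- Induction is on the typing derivation, which determines the fragment; the induction on the
execution of a loop is isolated in `Exec.exists_iteration`. -/
theorem StmtTyping.trans_correct {Γ Γ' : Ctx S} {s : Stmt S} (h : StmtTyping Γ s Γ') (l : ℕ)
    {M : Type u} (Ψ : Γ.Dom → M) {W : M ⊕ (h.trans l Ψ).N → Lifted S}
    (hW : (h.trans l Ψ).Solves W) {J : Set Idx} (hJ : FreeAbove l J) {E E' : Env S}
    (hE : Represents J (fun x => W (.inl (Ψ x))) E) (hx : Exec s E E') :
    Represents J (fun x => W ((h.trans l Ψ).out x)) E' := by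
  induction h generalizing l M J E E' with
  | seq h₁ h₂ ih₁ ih₂ =>
    cases hx with
    | seq hx₁ hx₂ =>
      have H₁ := ih₁ l Ψ (hW.comap (Frag.embeds_seq_left _ _)) hJ hE hx₁
      refine ih₂ l _ (hW.comap (Frag.embeds_seq_right _ _)) hJ (fun x => ?_) hx₂
      convert H₁ x using 6
      -- The two renamings of a node of the first step into the sequence agree.
      cases (h₁.trans l Ψ).out x <;> rfl
  | @asgn Γ x e τ he =>
    cases hx with
    | asgn hv =>
      rename_i v
      intro y
      by_cases hy : y.1 = x
      · refine ⟨v, by simp [hy], fun i hi => ?_⟩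
        have := he.trans_correct Ψ hW (hE.map_val hi)
        simp only [StmtTyping.trans, Frag.asgn, dif_pos hy]
        rw [hv] at this
        exact this
      · obtain ⟨w, hw, hwi⟩ := hE ⟨y.1, Ctx.dom_of_extend y hy⟩
        refine ⟨w, by simpa [hy] using hw, fun i hi => ?_⟩
        simp only [StmtTyping.trans, Frag.asgn, dif_neg hy]
        exact hwi i hi
  | ite he h₁ h₂ ih₁ ih₂ =>
    have Hc := fun i (hi : i ∈ J) => he.trans_correct Ψ (hW.comap (Frag.embeds_ite_cond _ _ _))
      (hE.map_val hi)
    have Hφ x := hW (IteNode.phi x) _ rfl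
    cases hx with
    | ite_true hb hx =>
      intro x
      obtain ⟨v, hv, hvi⟩ := ih₁ l Ψ (hW.comap (Frag.embeds_ite_then _ _ _)) hJ hE hx x
      refine ⟨v, hv, fun i hi => (congrFun (Hφ x) i).trans ?_⟩
      exact (semPhi_of_eq (b := true) ((Hc i hi).trans (by rw [hb]; rfl))).trans (hvi i hi)
    | ite_false hb hx =>
      intro x
      obtain ⟨v, hv, hvi⟩ := ih₂ l Ψ (hW.comap (Frag.embeds_ite_else _ _ _)) hJ hE hx x
      refine ⟨v, hv, fun i hi => (congrFun (Hφ x) i).trans ?_⟩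
      exact (semPhi_of_eq (b := false) ((Hc i hi).trans (by rw [hb]; rfl))).trans (hvi i hi)
  | sub h' hsub ih =>
    intro x
    exact ih l Ψ hW hJ hE hx ⟨x.1, hsub.dom x⟩
  | _ he hb ih =>
    rename_i Γ e s
    let Jk (k : ℕ) : Set Idx := {i | i ∈ J ∧ i (l + 1) = k}
    let θ (x : Γ.Dom) : Lifted S := W (.inr (.theta x))
    let c : Lifted S := W (.inr (((he.trans id).out ⟨⟩).elim .theta .cond))
    have hθ x : θ x = _ := hW (WhileNode.theta x) _ rfl
    have hnot : W (.inr .not) = semNot c := hW WhileNode.not _ rfl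
    have hpass : W (.inr .pass) = semPass (l + 1) (W (.inr .not)) := hW WhileNode.pass _ rfl
    have hc (k E) (hE : Represents (Jk k) θ E) (i) (hi : i ∈ Jk k) :
        c i = (e.eval E).map .val :=
      he.trans_correct id (hW.comap (Frag.embeds_while_cond _ _ _ _)) (hE.map_val hi)
    have hs (k E E') (hE : Represents (Jk k) θ E) (hx : Exec s E E') :
        Represents (Jk (k + 1)) θ E' := by
      intro x
      obtain ⟨v, hv, hvi⟩ :=
        ih (l + 1) id (hW.comap (Frag.embeds_while_body _ _ _ _)) (hJ.slice k) hE hx x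
      refine ⟨v, hv, fun i hi => (congrFun (hθ x) i).trans ?_⟩
      -- With counter `k + 1 ≠ 0`, `θ` takes the body's output at counter `k`.
      refine (if_neg (by rw [hi.2]; omega)).trans (hvi _ ⟨hJ i hi.1 _ (by omega) _, ?_⟩)
      simp [hi.2]
    have h0 : Represents (Jk 0) θ E := fun x =>
      (hE x).imp fun v hv => ⟨hv.1, fun i hi =>
        (congrFun (hθ x) i).trans ((if_pos hi.2).trans (hv.2 i hi.1))⟩
    obtain ⟨m, -, hlt, hm, hE'⟩ := hx.exists_iteration hc hs rfl 0 h0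
    have mem (i) (hi : i ∈ J) (k) : Function.update i (l + 1) k ∈ Jk k :=
      ⟨hJ i hi _ (by omega) k, by simp⟩
    intro x
    obtain ⟨v, hv, hvi⟩ := hE' x
    refine ⟨v, hv, fun i hi => ?_⟩
    have hp : W (.inr .pass) i = some (.nat m) := by
      rw [hpass, hnot]
      exact semPass_eq (fun j hj => semNot_of_eq ((hlt j (by omega) hj).2 _ (mem i hi j)))
        (semNot_of_eq (hm _ (mem i hi m)))
    have heval : W (.inr (.eval x)) = semEval (l + 1) (θ x) (W (.inr .pass)) :=
      hW (WhileNode.eval x) _ rfl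
    refine (congrFun heval i).trans ?_
    simp only [semEval, hp]
    -- `mon` disappears because every iteration before the exit has a represented environment, in
    -- which `x` is defined.
    rw [monotonize_update fun j hj => ?_]
    · exact hvi _ (mem i hi m)
    · obtain ⟨E₁, hE₁⟩ := (hlt j (by omega) hj).1
      obtain ⟨w, -, hw⟩ := hE₁ x
      simp [hw _ (mem i hi j)]

/-! ### Substitution of the parameters -/

theorem Peg.substs_of_fn {N : Type u} {G : Peg S N} {n : N} {f : FnApp S N} (h : G n = .fn f)
    (l : List (S.Var × Value S)) : G.substs l n = .fn f := by
  induction l generalizing G with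
  | nil => exact h
  | cons b l ih => exact ih (by simp [Peg.subst, h])

/-- The first matching entry wins, as later substitutions leave constants alone; a repeated variable
is why only some matching entry is asserted. -/
theorem Peg.substs_of_param {N : Type u} {G : Peg S N} {n : N} {x : S.Var} (h : G n = .param x)
    {l : List (S.Var × Value S)} (hx : ∃ b ∈ l, b.1 = x) :
    ∃ b ∈ l, b.1 = x ∧ G.substs l n = .fn (.const b.2) := by
  induction l generalizing G with
  | nil => simp at hx
  | cons b l ih =>
    by_cases hb : b.1 = x
    · exact ⟨b, by simp, hb, Peg.substs_of_fn (by simp [Peg.subst, h, hb]) l⟩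
    · obtain ⟨b', hb', hx', H⟩ := ih (G := G.subst b.1 b.2)
        (by simp [Peg.subst, h, Ne.symm hb]) (by simpa [hb] using hx)
      exact ⟨b', by simp [hb'], hx', H⟩

theorem Ctx.exists_mem_of_foldl_extend {ps : List (S.Var × S.Ty)} {Γ : Ctx S} {x : S.Var}
    (h : (ps.foldl (fun Γ b => Γ.extend b.1 b.2) Γ) x ≠ none) :
    Γ x ≠ none ∨ ∃ b ∈ ps, b.1 = x := by
  induction ps generalizing Γ with
  | nil => exact .inl h
  | cons b ps ih =>
    rcases ih h with h | ⟨b', hb', rfl⟩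
    · by_cases hb : b.1 = x
      · exact .inr ⟨b, by simp, hb⟩
      · exact .inl (by simpa [Ctx.extend, Function.update_of_ne (Ne.symm hb)] using h)
    · exact .inr ⟨b', by simp [hb'], rfl⟩

theorem Ctx.exists_mem_of_ofParams {ps : List (S.Var × S.Ty)} {x : S.Var}
    (h : Ctx.ofParams ps x ≠ none) : ∃ b ∈ ps, b.1 = x :=
  (Ctx.exists_mem_of_foldl_extend h).resolve_left fun h => h rfl

/-- Parameter nodes replaced by constants, the PEG of a program has a unique solution, and its
root evaluates to the result of the program. -/
theorem ProgTyping.evaluatesTo {p : Program S} (D : ProgTyping p) {E : Env S} {v : Value S}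
    {G : Peg S D.Node} (hfn : ∀ n f, D.peg n = .fn f → G n = .fn f)
    (hparam : ∀ x, ∃ w, E x.1 = some w ∧ G (.inl x) = .fn (.const w))
    (hv : p.Evaluates E v) : G.EvaluatesTo D.root (fun _ => 0) v := by
  have hfree : D.bodyTrans.ParamFree := D.body.paramFree_trans 0 id
  have hJ : FreeAbove 0 Set.univ := fun _ _ _ _ _ => trivial
  have hG (n) : ∃ f, G n = .fn f := by
    rcases n with x | n
    · exact (hparam x).elim fun w hw => ⟨_, hw.2⟩
    · exact (hfree n).elim fun f hf => ⟨f, hfn _ f hf⟩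
  have wf : WellFounded G.Dep := by
    refine ⟨fun q => ?_⟩
    refine D.body.progress 0 id (A := fun n i => Acc G.Dep (n, i)) ?_ hJ ?_ q.1 q.2 trivial
    · intro n f i hf h
      refine ⟨_, fun q hq => ?_⟩
      obtain ⟨f', hf', hq⟩ := hq
      obtain rfl : f = f' := by
        exact Cell.fn.inj ((hfn (.inr n) f hf).symm.trans hf')
      exact h _ _ hq
    -- A parameter node is now a constant and depends on nothing.
    · intro x i _
      refine ⟨_, fun q hq => ?_⟩
      obtain ⟨f, hf, hq⟩ := hq
      obtain ⟨w, -, hw⟩ := hparam x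
      obtain rfl := Cell.fn.inj (hw.symm.trans hf)
      exact hq.elim
  obtain ⟨V, hV⟩ := G.exists_isSemantics wf
  refine ⟨V, hV, fun V' hV' => hV'.unique wf hG hV, ?_⟩
  obtain ⟨E', hx, hret⟩ := hv
  obtain ⟨w, hw, hwi⟩ := D.body.trans_correct 0 id (W := V)
    (fun n f hf => hV _ f (hfn _ f hf)) hJ (E := E)
    (fun x => (hparam x).imp fun w hw => ⟨hw.1, fun i _ => congrFun (hV _ _ hw.2) i⟩) hx ⟨S.retvar, by simp [D.ret]⟩
  obtain rfl : w = v := Option.some.inj (hw.symm.trans hret)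
  exact hwi _ trivial

end Simple

theorem mainTheorem2 (S : Simple.Signature.{u}) (p : Simple.Program S)
    (D : Simple.ProgTyping p) (E : Simple.Env S)
    (c : Fin p.params.length → Simple.Value S)
    (hE : ∀ i, E (p.params.get i).1 = some (c i) ∧ (c i).1 = (p.params.get i).2)
    (v : Simple.Value S) :
    p.Evaluates E v →
      (D.peg.substs (List.ofFn fun i => ((p.params.get i).1, c i))).EvaluatesTo
        D.root (fun _ => 0) v := by
  refine D.evaluatesTo (fun n f hf => Simple.Peg.substs_of_fn hf _) fun x => ?_
  obtain ⟨b, hb, hbx⟩ := Simple.Ctx.exists_mem_of_ofParams x.2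
  obtain ⟨i, rfl⟩ := List.get_of_mem hb
  obtain ⟨b', hb', hx', H⟩ := Simple.Peg.substs_of_param (G := D.peg) (n := .inl x)
    (l := List.ofFn fun i => ((p.params.get i).1, c i)) rfl
    ⟨_, List.mem_ofFn.2 ⟨i, rfl⟩, hbx⟩
  obtain ⟨j, rfl⟩ := List.mem_ofFn.1 hb'
  -- The positions `i` and `j` may differ for a repeated parameter; `hE j` already identifies `c j`
  -- as the value of `x` in `E`.
  exact ⟨c j, hx' ▸ (hE j).1, H⟩
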